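/- Let $\mathcal P$ be a set of prime numbers with $2\notin\mathcal P$, and let $X$ be a compact totally disconnected Abelian group topologically isomorphic to the product $\prod_{p\in\mathcal P}X_p$ with the product topology, where each $X_p$ is either a finite cyclic group $\mathbb Z/p^{k_p}\mathbb Z$ (with an integer $k_p\ge 0$) with the discrete topology or the group $\mathbb Z_p$ of $p$-adic integers. Let $Y$ be the character group of $X$, let $I$ be the identity map of $X$, and let $\alpha$ be a topological automorphism of $X$. Let $\xi_1,\xi_2$ be independent random variables with values in $X$ and distributions $\mu_1,\mu_2$, and let $\hat\mu_j(y)=\int_X (x,y)\,d\mu_j(x)$, $y\in Y$, where $(x,y)$ is the value of the character $y$ at $x$. Assume that the conditional distribution of $L_2=\xi_1+\alpha\xi_2$ given $L_1=\xi_1+\xi_2$ is symmetric, i.e. that the random vectors $(L_1,L_2)$ and $(L_1,-L_2)$ are identically distributed, and that $$\{y\in Y: |\hat\mu_1(y)|=|\hat\mu_2(y)|=1\}=\{0\}.$$ Then $(I-\alpha)(X)=X$ and $\mu_1=\mu_2=\mu$ for some distribution $\mu$ on $X$. Moreover, $X$ is the smallest closed subgroup of $X$ containing the support of $\mu$, and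 the Haar distribution $m_{(I+\alpha)(X)}$ (the Haar measure of total mass $1$ on the compact subgroup $(I+\alpha)(X)$, regarded as a measure on $X$) is a factor of $\mu$, i.e. $\mu=m_{(I+\alpha)(X)}*\nu$ for some probability distribution $\nu$ on $X$. -/

import Mathlib

open MeasureTheory ProbabilityTheory

noncomputable section

/-- The topological group `F` is (up to topological isomorphism) either a cyclic `p`-group
`ℤ/p^k` with the discrete topology, or the group of `p`-adic integers. -/
def IsCyclicOrPadic (p : ℕ) (F : Type*) [AddCommGroup F] [TopologicalSpace F] : Prop :=
  (∃ k : ℕ, Nonempty (F ≃ₜ+ ZMod (p ^ k))) ∨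
    ∃ _ : Fact p.Prime, Nonempty (F ≃ₜ+ ℤ_[p])

/-- The characteristic function `μ̂(y) = ∫ (x, y) dμ(x)` of a distribution `μ` on the additive
group `X`, as a function on the character group (Mathlib's Pontryagin dual is written
multiplicatively, so the zero character is `1`). -/
def charFn {X : Type*} [AddCommGroup X] [TopologicalSpace X] [MeasurableSpace X]
    (μ : Measure X) (y : PontryaginDual (Multiplicative X)) : ℂ :=
  ∫ x, ((y (Multiplicative.ofAdd x) : Circle) : ℂ) ∂μ

/-- The conditional distribution of `L₂` given `L₁` is symmetric: the random vectors
`(L₁, L₂)` and `(L₁, -L₂)` are identically distributed. -/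
def CondSymmetric {Ω X : Type*} [MeasurableSpace Ω] [AddCommGroup X] [MeasurableSpace X]
    (L₂ L₁ : Ω → X) (P : Measure Ω) : Prop :=
  IdentDistrib (fun ω => (L₁ ω, L₂ ω)) (fun ω => (L₁ ω, -L₂ ω)) P P

/-- The Haar distribution `m_K` of a compact subgroup `K` of `X`, as a distribution on `X`:
the image under the inclusion `K → X` of the Haar measure of `K` of total mass `1`. -/
def haarDistribution {X : Type*} [AddCommGroup X] [TopologicalSpace X] [IsTopologicalAddGroup X]
    [MeasurableSpace X] [BorelSpace X] (K : AddSubgroup X) [CompactSpace K] : Measure X :=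
  (Measure.addHaarMeasure (⊤ : TopologicalSpace.PositiveCompacts K)).map (Subtype.val : K → X)

/-- `ρ` is a factor of `μ`: `μ = ρ * ν` for some distribution `ν`. -/
def IsFactor {X : Type*} [AddCommGroup X] [MeasurableSpace X] (ρ μ : Measure X) : Prop :=
  ∃ ν : Measure X, IsProbabilityMeasure ν ∧ μ = Measure.conv ρ ν

/-- The endomorphism `I + α`. -/
def idAdd {X : Type*} [AddCommGroup X] [TopologicalSpace X] (α : X ≃ₜ+ X) : X →+ X :=
  AddMonoidHom.id X + (α.toAddEquiv : X →+ X)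

/-- The endomorphism `I - α`. -/
def idSub {X : Type*} [AddCommGroup X] [TopologicalSpace X] (α : X ≃ₜ+ X) : X →+ X :=
  AddMonoidHom.id X - (α.toAddEquiv : X →+ X)

instance idAdd_range_compactSpace {X : Type*} [AddCommGroup X] [TopologicalSpace X]
    [IsTopologicalAddGroup X] [CompactSpace X] (α : X ≃ₜ+ X) :
    CompactSpace (idAdd α).range := by
  have h : Continuous (idAdd α) := by
    change Continuous fun x => x + α x
    exact continuous_id.add α.continuous_toFun
  have hc : IsCompact ((idAdd α).range : Set X) := by
    rw [AddMonoidHom.coe_range]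
    exact isCompact_range h
  exact isCompact_iff_compactSpace.mp hc

end

/-!
Write `f`, `g` for the characteristic functions of `μ₁`, `μ₂` and `a` for the adjoint of `α` on the
character group `Y`. Independence turns the symmetry of the conditional distribution into the
functional equation `f (u + v) g (u + a v) = f (u - v) g (u - a v)` on `Y`
(`CondSymmetric.charFn_mul_charFn`).

*Reduction to finite cyclic groups.* By the Chinese remainder theorem `X` has a topological
generator, and a character of `X` has finite odd order (`exists_isOddProcyclicGenerator`,
`IsOddProcyclicGenerator.exists_odd_pow_eq_one`). Hence `a` maps every character `y` to a multiple
of `y` (`IsOddProcyclicGenerator.exists_charComp_eq_pow`), and the equation can be studied on one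
cyclic group `ℤ / n` with `n` odd at a time, where `a` is multiplication by a unit.

*The equation on `ℤ / n`* (`heyde_ring_vanishing`, `heyde_ring`). Since `|f| = |g| = 1` only at
zero, the case `u = v` shows that `a - 1` is injective, hence a unit. With `t = (a + 1) / (a - 1)`
the equation yields `f w = f (t w) g ((t + 1) w)` and `g w = f ((1 - t) w) g (-t w)`, where `t + 1`
and `1 - t` are units. If `f w ≠ 0`, then `|f|` increases along the orbit `t ^ i w`, so it is
eventually constant there; at such a point `|f| = |g| = 1`, so the orbit reaches zero. If moreover
`t ^ 2 w = 0`, combining the two identities gives `f w = f (t w) g (-t w) f w`, so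
`|f (t w)| = |g (t w)| = 1` and `t w = 0`. Descending along the orbit, `f w ≠ 0` forces `t w = 0`,
that is `(1 + a) w = 0`; and there the first identity reads `f w = g w`.

*Conclusion.* Characters of a profinite abelian group separate closed subgroups from points
(`exists_char_eq_one_of_isClosed`), so distributions are determined by their characteristic
functions (`ext_of_charFn`) and `μ₁ = μ₂`. As `f` vanishes off the annihilator of `(I + α)(X)`,
convolution with the Haar distribution of that subgroup does not change `μ₁`
(`isFactor_haarDistribution`). Injectivity of `1 - a` dualizes to surjectivity of `I - α`, and the
support of `μ₁` generates `X` because `f` is `1` only at zero (`isLeast_top_of_charFn_eq_one`).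
-/

open MeasureTheory ProbabilityTheory
open scoped Topology

/-! ### The functional equation on a finite ring -/

/-- If `f` and `g` solve Heyde's functional equation, then `f` is supported on the annihilator of
`1 + a`, and there it agrees with `g`. The hypotheses on norms are those satisfied by
characteristic functions of distributions. -/
theorem heyde_ring_vanishing {R : Type*} [CommRing R] [Finite R] (htwo : IsUnit (2 : R))
    {a : R} (ha : IsUnit a) {f g : R → ℂ} (f0 : f 0 = 1) (g0 : g 0 = 1)
    (f_le : ∀ w, ‖f w‖ ≤ 1) (g_le : ∀ w, ‖g w‖ ≤ 1)
    (f_mul : ∀ c w, ‖f w‖ = 1 → ‖f (c * w)‖ = 1) (g_mul : ∀ c w, ‖g w‖ = 1 → ‖g (c * w)‖ = 1)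
    (hfg : ∀ w, ‖f w‖ = 1 → ‖g w‖ = 1 → w = 0)
    (heq : ∀ u v, f (u + v) * g (u + a * v) = f (u - v) * g (u - a * v)) :
    (∀ w, f w ≠ 0 → (1 + a) * w = 0) ∧ (∀ w, (1 + a) * w = 0 → f w = g w) := by
  have hb : IsUnit (a - 1) := by
    have hinj : Function.Injective (fun v : R => (a - 1) * v) := by
      refine (injective_iff_map_eq_zero (AddMonoidHom.mulLeft (a - 1))).2 fun v hv => ?_
      have hv : a * v = v := by
        have : (a - 1) * v = 0 := hv
        linear_combination this
      have h := heq v v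
      rw [hv, sub_self, f0, g0, one_mul, ← two_mul] at h
      have hn : ‖f (2 * v)‖ * ‖g (2 * v)‖ = 1 := by rw [← norm_mul, h, norm_one]
      have h1 := f_le (2 * v)
      have h2 := g_le (2 * v)
      have h3 := norm_nonneg (f (2 * v))
      have h4 := norm_nonneg (g (2 * v))
      exact (htwo.mul_right_eq_zero).1 (hfg _ (by nlinarith) (by nlinarith))
    obtain ⟨c, hc⟩ := Finite.surjective_of_injective hinj 1
    exact IsUnit.of_mul_eq_one c hc
  -- From here on `b` is the inverse of `a - 1`.
  obtain ⟨b, hb1⟩ := hb.exists_right_inv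
  -- With `t = (a + 1) / (a - 1)` the substitutions `u = a v` and `u = v` in the functional
  -- equation turn into the next two identities.
  obtain ⟨t, ht⟩ : ∃ t, t = (a + 1) * b := ⟨_, rfl⟩
  have hA : ∀ w, f w = f (t * w) * g ((t + 1) * w) := by
    intro w
    have h := heq (a * (b * w)) (b * w)
    rw [sub_self, g0, mul_one] at h
    rw [show f w = f (a * (b * w) - b * w) by
      congr 1; linear_combination (-w) * hb1, ← h]
    congr 2
    · rw [ht]; ring
    · rw [ht]; linear_combination w * hb1
  have hB : ∀ w, g w = f ((1 - t) * w) * g (-(t * w)) := by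
    intro w
    have h := heq (-(b * w)) (-(b * w))
    rw [sub_self, f0, one_mul] at h
    rw [show g w = g (-(b * w) - a * -(b * w)) by
      congr 1; linear_combination (-w) * hb1, ← h]
    congr 2
    · rw [ht]; linear_combination w * hb1
    · rw [ht]; ring
  have ht1 : IsUnit (t + 1) := by
    have : t + 1 = 2 * a * b := by rw [ht]; linear_combination -hb1
    rw [this]
    exact (htwo.mul ha).mul (IsUnit.of_mul_eq_one (a - 1) (by rw [mul_comm, hb1]))
  have ht2 : IsUnit (1 - t) := by
    have : 1 - t = -(2 * b) := by rw [ht]; linear_combination -hb1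
    rw [this]
    exact (htwo.mul (IsUnit.of_mul_eq_one (a - 1) (by rw [mul_comm, hb1]))).neg
  have hunit : ∀ (h : R → ℂ), (∀ c w, ‖h w‖ = 1 → ‖h (c * w)‖ = 1) →
      ∀ c w, IsUnit c → ‖h (c * w)‖ = 1 → ‖h w‖ = 1 := by
    rintro h hm c w hc h1
    obtain ⟨d, hd⟩ := hc.exists_left_inv
    have := hm d _ h1
    rwa [← mul_assoc, hd, one_mul] at this
  have hmono : ∀ w, ‖f w‖ ≤ ‖f (t * w)‖ := by
    intro w
    rw [hA w, norm_mul]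
    exact mul_le_of_le_one_right (norm_nonneg _) (g_le _)
  have hmono' : ∀ w i j, i ≤ j → ‖f (t ^ i * w)‖ ≤ ‖f (t ^ j * w)‖ := by
    intro w i j hij
    induction j, hij using Nat.le_induction with
    | base => exact le_rfl
    | succ j _ ih => refine ih.trans ((hmono _).trans_eq ?_); rw [pow_succ', mul_assoc]
  -- The norms `‖f (t ^ i * w)‖` increase with `i` and are eventually periodic, hence eventually
  -- constant, which forces `t ^ i * w` to become zero.
  have hnil : ∀ w, f w ≠ 0 → ∃ i, t ^ i * w = 0 := by
    intro w hw
    obtain ⟨i, j, hij, hp⟩ : ∃ i j : ℕ, i < j ∧ t ^ i = t ^ j := by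
      obtain ⟨i, j, hne, h⟩ := Finite.exists_ne_map_eq_of_infinite (fun i : ℕ => t ^ i)
      rcases lt_or_gt_of_ne hne with h' | h'
      exacts [⟨i, j, h', h⟩, ⟨j, i, h', h.symm⟩]
    refine ⟨i, ?_⟩
    have hpos : 0 < ‖f (t ^ i * w)‖ :=
      (norm_pos_iff.2 hw).trans_le (by simpa using hmono' w 0 i (Nat.zero_le i))
    have hle : ‖f (t * (t ^ i * w))‖ ≤ ‖f (t ^ i * w)‖ := by
      calc ‖f (t * (t ^ i * w))‖ = ‖f (t ^ (i + 1) * w)‖ := by rw [pow_succ', mul_assoc]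
        _ ≤ ‖f (t ^ j * w)‖ := hmono' w (i + 1) j hij
        _ = ‖f (t ^ i * w)‖ := by rw [hp]
    generalize t ^ i * w = z at hpos hle
    have hgz : ‖g z‖ = 1 := by
      refine hunit g g_mul _ z ht1 (le_antisymm (g_le _) ?_)
      have h := congrArg norm (hA z)
      rw [norm_mul] at h
      have := hmono z
      by_contra hlt
      push Not at hlt
      nlinarith [norm_nonneg (f (t * z))]
    refine hfg z (hunit f f_mul _ z ht2 (le_antisymm (f_le _) ?_)) hgz
    have h := congrArg norm (hB z)
    rw [norm_mul, hgz] at h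
    nlinarith [g_le (-(t * z)), norm_nonneg (f ((1 - t) * z)), norm_nonneg (g (-(t * z)))]
  -- If `t ^ 2 * w = 0`, both identities together give `f w = f (t w) g (-t w) f w`.
  have hstep : ∀ w, f w ≠ 0 → t * (t * w) = 0 → t * w = 0 := by
    intro w hw h2
    have h1 := hA w
    rw [hB ((t + 1) * w), show (1 - t) * ((t + 1) * w) = w by linear_combination -h2,
      show -(t * ((t + 1) * w)) = -(t * w) by linear_combination -h2] at h1
    have h3 : f (t * w) * g (-(t * w)) = 1 := by
      apply mul_left_cancel₀ hw
      linear_combination -h1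
    have h4 : ‖f (t * w)‖ * ‖g (-(t * w))‖ = 1 := by rw [← norm_mul, h3, norm_one]
    have h5 := f_le (t * w)
    have h6 := g_le (-(t * w))
    have h7 := norm_nonneg (f (t * w))
    have h8 := norm_nonneg (g (-(t * w)))
    refine hfg _ (by nlinarith) (hunit g g_mul (-1) _ isUnit_one.neg ?_)
    rw [neg_one_mul]
    nlinarith
  have hind : ∀ i w, f w ≠ 0 → t ^ i * w = 0 → t * w = 0 := by
    intro i
    induction i with
    | zero => intro w _ h; rw [pow_zero, one_mul] at h; rw [h, mul_zero]
    | succ i ih =>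
      intro w hw h
      have htw : f (t * w) ≠ 0 :=
        norm_pos_iff.1 ((norm_pos_iff.2 hw).trans_le (hmono w))
      exact hstep w hw (ih _ htw (by rw [← h, pow_succ]; ring))
  refine ⟨fun w hw => ?_, fun w hw => ?_⟩
  · obtain ⟨i, hi⟩ := hnil w hw
    have := hind i w hw hi
    rw [ht] at this
    linear_combination (a - 1) * this - (a + 1) * w * hb1
  · have htw : t * w = 0 := by rw [ht]; linear_combination b * hw
    rw [hA w, htw, f0, one_mul, add_mul, htw, zero_add, one_mul]

/-- Solutions of Heyde's functional equation on a finite ring in which `2` is invertible coincide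
and vanish off the annihilator of `1 + a`. -/
theorem heyde_ring {R : Type*} [CommRing R] [Finite R] (htwo : IsUnit (2 : R))
    {a : R} (ha : IsUnit a) {f g : R → ℂ} (f0 : f 0 = 1) (g0 : g 0 = 1)
    (f_le : ∀ w, ‖f w‖ ≤ 1) (g_le : ∀ w, ‖g w‖ ≤ 1)
    (f_mul : ∀ c w, ‖f w‖ = 1 → ‖f (c * w)‖ = 1) (g_mul : ∀ c w, ‖g w‖ = 1 → ‖g (c * w)‖ = 1)
    (hfg : ∀ w, ‖f w‖ = 1 → ‖g w‖ = 1 → w = 0)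
    (heq : ∀ u v, f (u + v) * g (u + a * v) = f (u - v) * g (u - a * v)) :
    f = g ∧ ∀ w, (1 + a) * w ≠ 0 → f w = 0 := by
  obtain ⟨hf, hfeq⟩ := heyde_ring_vanishing htwo ha f0 g0 f_le g_le f_mul g_mul hfg heq
  obtain ⟨b, hb⟩ := ha.exists_right_inv
  -- The equation is symmetric under exchanging `f` with `g` and `a` with its inverse `b`.
  obtain ⟨hg, -⟩ := heyde_ring_vanishing (a := b) htwo
    (IsUnit.of_mul_eq_one a (by rw [mul_comm, hb])) g0 f0
    g_le f_le g_mul f_mul (fun w h1 h2 => hfg w h2 h1) (fun u v => by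
      have h := heq u (b * v)
      rw [← mul_assoc, hb, one_mul] at h
      rw [mul_comm, h, mul_comm])
  refine ⟨funext fun w => ?_, fun w hw => by_contra fun h => hw (hf w h)⟩
  by_cases hw : (1 + a) * w = 0
  · exact hfeq w hw
  · have hfw : f w = 0 := by_contra fun h => hw (hf w h)
    have hgw : g w = 0 := by_contra fun h => hw (by linear_combination a * hg w h - w * hb)
    rw [hfw, hgw]

/-! ### Odd procyclic groups and their characters -/

/-- `x₀` is a topological generator of `X`, and `X` is an inverse limit of cyclic groups of odd
order: modulo every neighbourhood of zero, `X` has odd exponent and consists of the multiples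
of `x₀`. -/
def IsOddProcyclicGenerator {X : Type*} [AddCommGroup X] [TopologicalSpace X] (x₀ : X) : Prop :=
  ∀ U ∈ 𝓝 (0 : X), (∃ N : ℕ, Odd N ∧ ∀ x : X, N • x ∈ U) ∧ ∀ x : X, ∃ k : ℕ, x - k • x₀ ∈ U

theorem IsCyclicOrPadic.exists_generator {p : ℕ} {F : Type*} [AddCommGroup F]
    [TopologicalSpace F] (hp : p.Prime) (hF : IsCyclicOrPadic p F) :
    ∃ g : F, (∀ U ∈ 𝓝 (0 : F), ∃ m : ℕ, ∀ z : F, (p ^ m) • z ∈ U) ∧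
      ∀ (x : F) (m : ℕ), ∃ (k : ℕ) (z : F), x - k • g = (p ^ m) • z := by
  rcases hF with ⟨k, ⟨e⟩⟩ | ⟨_, ⟨e⟩⟩
  · refine ⟨e.symm 1, fun U hU => ⟨k, fun z => ?_⟩, fun x m => ?_⟩
    · have : (p ^ k) • z = 0 := by
        apply e.injective
        rw [map_nsmul, map_zero, nsmul_eq_mul, ZMod.natCast_self, zero_mul]
      rw [this]
      exact mem_of_mem_nhds hU
    · have : NeZero (p ^ k) := ⟨pow_ne_zero _ hp.ne_zero⟩
      refine ⟨(e x).val, 0, e.injective ?_⟩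
      simp
  · refine ⟨e.symm 1, fun U hU => ?_, fun x m => ?_⟩
    · have hV : (e.symm : ℤ_[p] → F) ⁻¹' U ∈ 𝓝 (0 : ℤ_[p]) :=
        e.symm.continuous_toFun.continuousAt.preimage_mem_nhds (by simpa using hU)
      obtain ⟨ε, hε, hball⟩ := Metric.mem_nhds_iff.1 hV
      obtain ⟨m, hm⟩ := PadicInt.exists_pow_neg_lt p hε
      refine ⟨m, fun z => ?_⟩
      have h : (p ^ m) • e z ∈ Metric.ball (0 : ℤ_[p]) ε := by
        rw [mem_ball_zero_iff, nsmul_eq_mul]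
        refine lt_of_le_of_lt ?_ hm
        rw [norm_mul]
        push_cast
        rw [PadicInt.norm_p_pow]
        exact mul_le_of_le_one_right (by positivity) (PadicInt.norm_le_one _)
      have h' := hball h
      rwa [Set.mem_preimage, map_nsmul, e.symm_apply_apply] at h'
    · obtain ⟨z, hz⟩ := Ideal.mem_span_singleton.1 (PadicInt.appr_spec m (e x))
      refine ⟨(e x).appr m, e.symm z, e.injective ?_⟩
      simp [hz]

theorem IsCyclicOrPadic.secondCountableTopology {p : ℕ} {F : Type*} [AddCommGroup F]
    [TopologicalSpace F] (hp : p.Prime) (hF : IsCyclicOrPadic p F) :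
    SecondCountableTopology F := by
  rcases hF with ⟨k, ⟨e⟩⟩ | ⟨_, ⟨e⟩⟩
  · have : NeZero (p ^ k) := ⟨pow_ne_zero _ hp.ne_zero⟩
    exact e.toHomeomorph.secondCountableTopology
  · exact e.toHomeomorph.secondCountableTopology

theorem exists_isOddProcyclicGenerator {S : Set ℕ} (hprime : ∀ p ∈ S, Nat.Prime p)
    (htwo : 2 ∉ S) {F : S → Type*} [∀ p, AddCommGroup (F p)] [∀ p, TopologicalSpace (F p)]
    (hF : ∀ p : S, IsCyclicOrPadic (p : ℕ) (F p))
    {X : Type*} [AddCommGroup X] [TopologicalSpace X] (e : X ≃ₜ+ (∀ p : S, F p)) :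
    ∃ x₀ : X, IsOddProcyclicGenerator x₀ := by
  choose g hg hgen using fun p : S => (hF p).exists_generator (hprime p p.2)
  refine ⟨e.symm g, fun U hU => ?_⟩
  have hV : (e.symm : (∀ p : S, F p) → X) ⁻¹' U ∈ 𝓝 (0 : ∀ p : S, F p) :=
    e.symm.continuous_toFun.continuousAt.preimage_mem_nhds (by simpa using hU)
  rw [nhds_pi, Filter.mem_pi'] at hV
  obtain ⟨T, V, hV, hsub⟩ := hV
  choose m hm using fun p : S => hg p (V p) (hV p)
  have key : ∀ x : X, (∀ p ∈ T, ∃ z, e x p = ((p : ℕ) ^ m p) • z) → x ∈ U := by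
    intro x hx
    have : e x ∈ (T : Set S).pi V := by
      intro p hp
      obtain ⟨z, hz⟩ := hx p hp
      rw [hz]
      exact hm p z
    simpa using hsub this
  refine ⟨⟨∏ p ∈ T, (p : ℕ) ^ m p, ?_, fun x => key _ fun p hp => ?_⟩, fun x => ?_⟩
  · refine Finset.prod_induction _ Odd (fun _ _ => Odd.mul) odd_one fun p _ => Odd.pow ?_
    exact (hprime p p.2).odd_of_ne_two fun h => htwo (h ▸ p.2)
  · refine ⟨(∏ q ∈ T.erase p, (q : ℕ) ^ m q) • e x p, ?_⟩
    rw [← mul_smul, Finset.mul_prod_erase T (fun q : S => (q : ℕ) ^ m q) hp, map_nsmul]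
    rfl
  · choose k z hz using fun p : S => hgen p (e x p) (m p)
    obtain ⟨n, hn⟩ := Nat.chineseRemainderOfFinset k (fun p : S => (p : ℕ) ^ m p) T
      (fun p _ => pow_ne_zero _ (hprime p p.2).ne_zero) (fun p _ q _ hpq =>
        Nat.Coprime.pow _ _ ((Nat.coprime_primes (hprime p p.2) (hprime q q.2)).2
          fun h => hpq (Subtype.ext h)))
    refine ⟨n, key _ fun p hp => ?_⟩
    obtain ⟨c, hc⟩ := (Nat.modEq_iff_dvd.1 (hn p hp))
    refine ⟨z p + c • g p, ?_⟩
    have h1 : (k p : ℤ) • g p = (n : ℤ) • g p + (((p : ℕ) ^ m p : ℕ) : ℤ) • c • g p := by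
      rw [← mul_smul, ← add_smul, ← hc]
      congr 1; ring
    rw [natCast_zsmul, natCast_zsmul, natCast_zsmul] at h1
    rw [smul_add, ← hz p, map_sub, map_nsmul, e.apply_symm_apply, Pi.sub_apply,
      Pi.smul_apply, h1]
    abel

section Characters

variable {X : Type*} [AddCommGroup X] [TopologicalSpace X]

/-- The character `y ∘ φ`, the image of `y` under the adjoint of the continuous
homomorphism `φ`. -/
noncomputable def charComp (y : PontryaginDual (Multiplicative X)) (φ : X →ₜ+ X) :
    PontryaginDual (Multiplicative X) :=
  PontryaginDual.map
    (⟨AddMonoidHom.toMultiplicative φ.toAddMonoidHom, φ.continuous_toFun⟩ :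
      Multiplicative X →ₜ* Multiplicative X) y

theorem charComp_apply (y : PontryaginDual (Multiplicative X)) (φ : X →ₜ+ X) (x : X) :
    charComp y φ (Multiplicative.ofAdd x) = y (Multiplicative.ofAdd (φ x)) := rfl

theorem pontryaginDual_pow_apply {A : Type*} [Monoid A] [TopologicalSpace A]
    (y : PontryaginDual A) (n : ℕ) (x : A) : (y ^ n) x = y x ^ n := by
  induction n with
  | zero => rw [pow_zero, pow_zero]; rfl
  | succ n ih => rw [pow_succ, pow_succ, ← ih]; rfl

theorem continuous_char_ofAdd (y : PontryaginDual (Multiplicative X)) :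
    Continuous fun x : X => y (Multiplicative.ofAdd x) :=
  (map_continuous y).comp continuous_ofAdd

theorem continuous_coe_char_ofAdd (y : PontryaginDual (Multiplicative X)) :
    Continuous fun x : X => ((y (Multiplicative.ofAdd x) : Circle) : ℂ) :=
  continuous_subtype_val.comp (continuous_char_ofAdd y)

namespace IsOddProcyclicGenerator

variable {x₀ : X}

/-- The circle has no small subgroups, so a character is trivial on `N X` for some odd `N`. -/
theorem exists_odd_pow_eq_one (h : IsOddProcyclicGenerator x₀)
    (y : PontryaginDual (Multiplicative X)) : ∃ N : ℕ, Odd N ∧ y ^ N = 1 := by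
  have hU : (fun x : X => y (Multiplicative.ofAdd x)) ⁻¹' Circle.centeredArc (Real.pi / 2) ∈
      𝓝 (0 : X) := by
    refine ((Circle.isOpen_centeredArc _).preimage (continuous_char_ofAdd y)).mem_nhds ?_
    rw [Set.mem_preimage, ofAdd_zero, map_one,
      Circle.mem_centeredArc (by linarith [Real.pi_pos])]
    simp [Real.pi_pos]
  obtain ⟨N, hN, hmem⟩ := (h _ hU).1
  refine ⟨N, hN, PontryaginDual.ext fun x => ?_⟩
  refine Circle.eq_one_of_forall_pow_mem_centeredArc_pi_div_two fun n _ => ?_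
  have := hmem (n • x.toAdd)
  rw [Set.mem_preimage, ofAdd_nsmul, ofAdd_nsmul, map_pow, map_pow, ofAdd_toAdd] at this
  rwa [pontryaginDual_pow_apply, ← pow_mul, mul_comm, pow_mul]

theorem eq_one_of_apply_eq_one (h : IsOddProcyclicGenerator x₀)
    {y : PontryaginDual (Multiplicative X)} (hy : y (Multiplicative.ofAdd x₀) = 1) : y = 1 := by
  refine PontryaginDual.ext fun x => by_contra fun hx => ?_
  have hU : {z : X | y (Multiplicative.ofAdd z) ≠ y x} ∈ 𝓝 (0 : X) := by
    refine (isOpen_ne_fun (continuous_char_ofAdd y) continuous_const).mem_nhds ?_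
    rw [Set.mem_ofPred_eq, ofAdd_zero, map_one]
    exact Ne.symm hx
  obtain ⟨k, hk⟩ := (h _ hU).2 x.toAdd
  refine hk ?_
  rw [ofAdd_sub, ofAdd_nsmul, map_div, map_pow, hy, one_pow, div_one, ofAdd_toAdd]

theorem ext_of_apply_eq (h : IsOddProcyclicGenerator x₀)
    {y z : PontryaginDual (Multiplicative X)}
    (hyz : y (Multiplicative.ofAdd x₀) = z (Multiplicative.ofAdd x₀)) : y = z := by
  rw [← div_eq_one]
  refine h.eq_one_of_apply_eq_one ?_
  change y (Multiplicative.ofAdd x₀) / z (Multiplicative.ofAdd x₀) = 1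
  rw [hyz, div_self']

/-- Cyclic subgroups of the dual are invariant under adjoints of continuous endomorphisms:
`y (φ x₀)` is a power of the primitive root of unity `y x₀`. -/
theorem exists_charComp_eq_pow (h : IsOddProcyclicGenerator x₀)
    (y : PontryaginDual (Multiplicative X)) (φ : X →ₜ+ X) :
    ∃ a : ℕ, charComp y φ = y ^ a := by
  obtain ⟨N, hN, hyN⟩ := h.exists_odd_pow_eq_one y
  have hpos : 0 < orderOf y := orderOf_pos_iff.2 (isOfFinOrder_iff_pow_eq_one.2 ⟨N, hN.pos, hyN⟩)
  have : NeZero (orderOf y) := ⟨hpos.ne'⟩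
  have hprim : IsPrimitiveRoot ((y (Multiplicative.ofAdd x₀) : Circle) : ℂ) (orderOf y) := by
    refine ⟨?_, fun l hl => orderOf_dvd_of_pow_eq_one (h.eq_one_of_apply_eq_one ?_)⟩
    · rw [← Circle.coe_pow, ← pontryaginDual_pow_apply, pow_orderOf_eq_one]; simp
    · rw [pontryaginDual_pow_apply]
      exact Circle.ext (by simpa using hl)
  obtain ⟨a, -, ha⟩ := hprim.eq_pow_of_pow_eq_one
    (ξ := ((y (Multiplicative.ofAdd (φ x₀)) : Circle) : ℂ)) (by
      rw [← Circle.coe_pow, ← pontryaginDual_pow_apply, pow_orderOf_eq_one]; simp)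
  refine ⟨a, h.ext_of_apply_eq (Circle.ext ?_)⟩
  rw [charComp_apply, ← ha, pontryaginDual_pow_apply, Circle.coe_pow]

end IsOddProcyclicGenerator

/-- Characters of a profinite abelian group separate closed subgroups from points. -/
theorem exists_char_eq_one_of_isClosed [IsTopologicalAddGroup X] [CompactSpace X]
    [TotallyDisconnectedSpace X] {H : AddSubgroup X} (hH : IsClosed (H : Set X)) {x : X}
    (hx : x ∉ H) : ∃ y : PontryaginDual (Multiplicative X),
      (∀ h ∈ H, y (Multiplicative.ofAdd h) = 1) ∧ y (Multiplicative.ofAdd x) ≠ 1 := by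
  obtain ⟨K, hK, hHK, hxK⟩ : ∃ K : AddSubgroup X, IsOpen (K : Set X) ∧ H ≤ K ∧ x ∉ K := by
    have h := ProfiniteGrp.closedAddSubgroup_eq_sInf_open (⟨H, hH⟩ : ClosedAddSubgroup X)
    have hx' : x ∉ sInf {N : AddSubgroup X | IsOpen (N : Set X) ∧ H ≤ N} := by
      intro hmem
      exact hx (h.ge hmem)
    rw [AddSubgroup.mem_sInf] at hx'
    push Not at hx'
    obtain ⟨K, ⟨h1, h2⟩, h3⟩ := hx'
    exact ⟨K, h1, h2, h3⟩
  have : DiscreteTopology (X ⧸ K) := QuotientAddGroup.discreteTopology hK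
  have : Finite (X ⧸ K) := K.quotient_finite_of_isOpen hK
  obtain ⟨ψ, hψ⟩ := AddChar.exists_apply_ne_zero.2
    (mt (QuotientAddGroup.eq_zero_iff x).1 hxK)
  refine ⟨⟨(AddChar.circleEquivComplex.symm ψ).toMonoidHom.comp
    (AddMonoidHom.toMultiplicative (QuotientAddGroup.mk' K)), ?_⟩, fun h hh => ?_, fun h => hψ ?_⟩
  · exact (continuous_of_discreteTopology (f := AddChar.circleEquivComplex.symm ψ)).comp
      (continuous_quot_mk.comp continuous_toAdd)
  · change AddChar.circleEquivComplex.symm ψ (h : X ⧸ K) = 1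
    rw [(QuotientAddGroup.eq_zero_iff h).2 (hHK hh), AddChar.map_zero_eq_one]
  · change AddChar.circleEquivComplex.symm ψ (x : X ⧸ K) = 1 at h
    exact (congrArg (fun z : Circle => (z : ℂ)) h).trans Circle.coe_one

end Characters

/-! ### Characteristic functions -/

section CharFn

variable {X : Type*} [AddCommGroup X] [TopologicalSpace X] [MeasurableSpace X]

theorem charFn_one (μ : Measure X) [IsProbabilityMeasure μ] : charFn μ 1 = 1 := by
  simp [charFn]

theorem norm_charFn_le_one (μ : Measure X) [IsProbabilityMeasure μ]
    (y : PontryaginDual (Multiplicative X)) : ‖charFn μ y‖ ≤ 1 := by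
  refine (norm_integral_le_of_norm_le_const (C := 1) (ae_of_all _ fun x => ?_)).trans (by simp)
  exact (Circle.norm_coe _).le

theorem ae_eq_charFn_of_norm_eq_one {μ : Measure X} [IsProbabilityMeasure μ]
    {y : PontryaginDual (Multiplicative X)} (h : ‖charFn μ y‖ = 1) :
    ∀ᵐ x ∂μ, ((y (Multiplicative.ofAdd x) : Circle) : ℂ) = charFn μ y := by
  have hle : ∀ᵐ x ∂μ, ‖((y (Multiplicative.ofAdd x) : Circle) : ℂ)‖ ≤ 1 :=
    ae_of_all _ fun x => (Circle.norm_coe _).le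
  rcases ae_eq_const_or_norm_integral_lt_of_norm_le_const hle with h' | h'
  · filter_upwards [h'] with x hx
    rw [hx, Function.const_apply, average_eq_integral]
    rfl
  · rw [probReal_univ, one_mul] at h'
    exact absurd h h'.ne

theorem norm_charFn_pow_eq_one {μ : Measure X} [IsProbabilityMeasure μ]
    {y : PontryaginDual (Multiplicative X)} (h : ‖charFn μ y‖ = 1) (n : ℕ) :
    ‖charFn μ (y ^ n)‖ = 1 := by
  have : charFn μ (y ^ n) = charFn μ y ^ n := by
    rw [charFn, integral_congr_ae (g := fun _ => charFn μ y ^ n)]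
    · simp
    · filter_upwards [ae_eq_charFn_of_norm_eq_one h] with x hx
      rw [pontryaginDual_pow_apply, Circle.coe_pow, hx]
  rw [this, norm_pow, h, one_pow]

/-- A distribution is concentrated on no proper closed subgroup if its characteristic function
takes the value `1` only at the zero character. -/
theorem isLeast_top_of_charFn_eq_one [IsTopologicalAddGroup X] [CompactSpace X]
    [TotallyDisconnectedSpace X] [SecondCountableTopology X] {μ : Measure X}
    [IsProbabilityMeasure μ] (h : ∀ y, charFn μ y = 1 → y = 1) :
    IsLeast {H : AddSubgroup X | IsClosed (H : Set X) ∧ μ.support ⊆ (H : Set X)} ⊤ := by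
  refine ⟨⟨isClosed_univ, Set.subset_univ _⟩, fun H ⟨hH, hsupp⟩ x _ => by_contra fun hx => ?_⟩
  obtain ⟨y, hy, hyx⟩ := exists_char_eq_one_of_isClosed hH hx
  refine hyx ?_
  rw [h y, PontryaginDual.one_apply]
  rw [charFn, integral_congr_ae (g := fun _ => (1 : ℂ))]
  · simp
  · filter_upwards [Measure.support_mem_ae (μ := μ)] with z hz
    rw [hy z (hsupp hz), Circle.coe_one]

variable [BorelSpace X]

theorem integrable_char (μ : Measure X) [IsFiniteMeasure μ]
    (y : PontryaginDual (Multiplicative X)) :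
    Integrable (fun x : X => ((y (Multiplicative.ofAdd x) : Circle) : ℂ)) μ :=
  Integrable.of_bound (continuous_coe_char_ofAdd y).aestronglyMeasurable 1
    (ae_of_all _ fun _ => (Circle.norm_coe _).le)

/-- On a metrizable profinite abelian group a distribution is determined by its characteristic
function: characters separate points, and their linear span is a star subalgebra. -/
theorem ext_of_charFn [IsTopologicalAddGroup X] [CompactSpace X] [TotallyDisconnectedSpace X]
    [SecondCountableTopology X] {μ ν : Measure X} [IsFiniteMeasure μ] [IsFiniteMeasure ν]
    (h : ∀ y, charFn μ y = charFn ν y) : μ = ν := by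
  let _ : MetricSpace X := TopologicalSpace.metrizableSpaceMetric X
  let c : PontryaginDual (Multiplicative X) → BoundedContinuousFunction X ℂ := fun y =>
    BoundedContinuousFunction.mkOfCompact ⟨_, continuous_coe_char_ofAdd y⟩
  have hc : ∀ y x, c y x = ((y (Multiplicative.ofAdd x) : Circle) : ℂ) := fun y x => rfl
  have hclos : ∀ f ∈ Submonoid.closure (Set.range c ∪ star (Set.range c)), f ∈ Set.range c := by
    intro f hf
    induction hf using Submonoid.closure_induction with
    | mem f hf =>
      rcases hf with hf | ⟨y, hy⟩
      · exact hf
      · refine ⟨y⁻¹, ?_⟩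
        rw [← star_star f, ← hy]
        ext x
        change (((y (Multiplicative.ofAdd x))⁻¹ : Circle) : ℂ) = star (c y x)
        rw [hc, Circle.coe_inv_eq_conj]
        rfl
    | one => exact ⟨1, by ext x; rw [hc]; simp⟩
    | mul f g _ _ hf hg =>
      obtain ⟨y, rfl⟩ := hf
      obtain ⟨z, rfl⟩ := hg
      exact ⟨y * z, rfl⟩
  refine ext_of_forall_mem_subalgebra_integral_eq_of_polish (𝕜 := ℂ)
    (A := StarAlgebra.adjoin ℂ (Set.range c)) ?_ ?_
  · intro x z hxz
    have hx : x - z ∉ (⊥ : AddSubgroup X) := by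
      rwa [AddSubgroup.mem_bot, sub_eq_zero]
    obtain ⟨y, -, hy⟩ := exists_char_eq_one_of_isClosed
      (by rw [AddSubgroup.coe_bot]; exact isClosed_singleton) hx
    refine ⟨_, ⟨_, ⟨c y, StarAlgebra.subset_adjoin ℂ _ ⟨y, rfl⟩, rfl⟩, rfl⟩, fun heq => hy ?_⟩
    have heq' : y (Multiplicative.ofAdd x) = y (Multiplicative.ofAdd z) := Circle.ext heq
    rw [ofAdd_sub, map_div, heq', div_self']
  · intro f hf
    have hf' : f ∈ Subalgebra.toSubmodule (StarAlgebra.adjoin ℂ (Set.range c)).toSubalgebra := hf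
    rw [StarAlgebra.adjoin_eq_span] at hf'
    clear hf
    induction hf' using Submodule.span_induction with
    | mem f hf =>
      obtain ⟨y, rfl⟩ := hclos f hf
      exact h y
    | zero => simp
    | add f g _ _ hf hg =>
      simp only [BoundedContinuousFunction.coe_add, Pi.add_apply]
      rw [integral_add (f.integrable μ) (g.integrable μ),
        integral_add (f.integrable ν) (g.integrable ν), hf, hg]
    | smul a f _ hf =>
      simp only [BoundedContinuousFunction.coe_smul]
      rw [integral_smul, integral_smul, hf]

theorem charFn_conv [IsTopologicalAddGroup X] [SecondCountableTopology X]
    (μ ν : Measure X) [IsFiniteMeasure μ] [IsFiniteMeasure ν]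
    (y : PontryaginDual (Multiplicative X)) :
    charFn (Measure.conv μ ν) y = charFn μ y * charFn ν y := by
  rw [charFn, integral_conv (integrable_char _ y)]
  simp only [ofAdd_add, map_mul, Circle.coe_mul]
  simp only [integral_const_mul, integral_mul_const]
  rfl

theorem isProbabilityMeasure_addHaarMeasure_top [IsTopologicalAddGroup X] (K : AddSubgroup X)
    [CompactSpace K] : IsProbabilityMeasure
      (Measure.addHaarMeasure (⊤ : TopologicalSpace.PositiveCompacts K)) :=
  ⟨by simpa using Measure.addHaarMeasure_self (K₀ := (⊤ : TopologicalSpace.PositiveCompacts K))⟩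

theorem isProbabilityMeasure_haarDistribution [IsTopologicalAddGroup X] (K : AddSubgroup X)
    [CompactSpace K] : IsProbabilityMeasure (haarDistribution K) := by
  have := isProbabilityMeasure_addHaarMeasure_top K
  exact Measure.isProbabilityMeasure_map measurable_subtype_coe.aemeasurable

theorem charFn_haarDistribution_eq_one [IsTopologicalAddGroup X] (K : AddSubgroup X)
    [CompactSpace K] {y : PontryaginDual (Multiplicative X)}
    (hy : ∀ x ∈ K, y (Multiplicative.ofAdd x) = 1) : charFn (haarDistribution K) y = 1 := by
  have := isProbabilityMeasure_addHaarMeasure_top K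
  rw [charFn, haarDistribution, integral_map measurable_subtype_coe.aemeasurable
    (continuous_coe_char_ofAdd y).aestronglyMeasurable]
  simp [hy]

theorem charFn_haarDistribution_eq_zero [IsTopologicalAddGroup X] (K : AddSubgroup X)
    [CompactSpace K] {y : PontryaginDual (Multiplicative X)} {x : X} (hx : x ∈ K)
    (hy : y (Multiplicative.ofAdd x) ≠ 1) : charFn (haarDistribution K) y = 0 := by
  rw [charFn, haarDistribution, integral_map measurable_subtype_coe.aemeasurable
    (continuous_coe_char_ofAdd y).aestronglyMeasurable]
  have h := integral_add_left_eq_self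
    (μ := Measure.addHaarMeasure (⊤ : TopologicalSpace.PositiveCompacts K))
    (fun z : K => ((y (Multiplicative.ofAdd (z : X)) : Circle) : ℂ)) ⟨x, hx⟩
  simp only [AddSubgroup.coe_add, ofAdd_add, map_mul, Circle.coe_mul] at h
  rw [integral_const_mul] at h
  refine (mul_eq_zero.1 (show (((y (Multiplicative.ofAdd x) : Circle) : ℂ) - 1) * _ = 0 by
    rw [sub_mul, one_mul, sub_eq_zero]; exact h)).resolve_left fun h0 => hy ?_
  exact Circle.ext (by simpa using sub_eq_zero.1 h0)

/-- A distribution whose characteristic function vanishes at all characters that are nontrivial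
on `K` absorbs the Haar distribution of `K`. -/
theorem isFactor_haarDistribution [IsTopologicalAddGroup X] [CompactSpace X]
    [TotallyDisconnectedSpace X] [SecondCountableTopology X] {μ : Measure X}
    [IsProbabilityMeasure μ] (K : AddSubgroup X) [CompactSpace K]
    (h : ∀ y, ∀ x ∈ K, y (Multiplicative.ofAdd x) ≠ 1 → charFn μ y = 0) :
    IsFactor (haarDistribution K) μ := by
  have := isProbabilityMeasure_haarDistribution K
  refine ⟨μ, inferInstance, ext_of_charFn fun y => ?_⟩
  rw [charFn_conv]
  by_cases hy : ∀ x ∈ K, y (Multiplicative.ofAdd x) = 1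
  · rw [charFn_haarDistribution_eq_one K hy, one_mul]
  · push Not at hy
    obtain ⟨x, hx, hyx⟩ := hy
    rw [h y x hx hyx, mul_zero]

end CharFn

/-! ### Heyde's functional equation on the character group -/

section Heyde

variable {X : Type*} [AddCommGroup X] [TopologicalSpace X]

theorem charComp_pow (y : PontryaginDual (Multiplicative X)) (φ : X →ₜ+ X) (n : ℕ) :
    charComp (y ^ n) φ = charComp y φ ^ n := by
  refine PontryaginDual.ext fun x => ?_
  rw [pontryaginDual_pow_apply]
  exact pontryaginDual_pow_apply y n _

variable [MeasurableSpace X]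

/-- Symmetry of the conditional distribution of `ξ₁ + α ξ₂` given `ξ₁ + ξ₂`, expressed by
characteristic functions. -/
theorem CondSymmetric.charFn_mul_charFn [BorelSpace X] {α : X →ₜ+ X}
    {Ω : Type*} [MeasurableSpace Ω] {P : Measure Ω} {ξ₁ ξ₂ : Ω → X} {μ₁ μ₂ : Measure X}
    (hξ₁ : HasLaw ξ₁ μ₁ P) (hξ₂ : HasLaw ξ₂ μ₂ P) (hindep : IndepFun ξ₁ ξ₂ P)
    (hsymm : CondSymmetric (fun ω => ξ₁ ω + α (ξ₂ ω)) (fun ω => ξ₁ ω + ξ₂ ω) P)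
    (u v : PontryaginDual (Multiplicative X)) :
    charFn μ₁ (u * v) * charFn μ₂ (u * charComp v α) =
      charFn μ₁ (u / v) * charFn μ₂ (u / charComp v α) := by
  have hprod : ∀ y z : PontryaginDual (Multiplicative X),
      charFn μ₁ y * charFn μ₂ z = ∫ ω, ((y (Multiplicative.ofAdd (ξ₁ ω)) : Circle) : ℂ) *
        ((z (Multiplicative.ofAdd (ξ₂ ω)) : Circle) : ℂ) ∂P := by
    intro y z
    rw [hindep.integral_fun_comp_mul_comp hξ₁.aemeasurable hξ₂.aemeasurable
      (f := fun x : X => ((y (Multiplicative.ofAdd x) : Circle) : ℂ))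
      (g := fun x : X => ((z (Multiplicative.ofAdd x) : Circle) : ℂ))
      (continuous_coe_char_ofAdd y).aestronglyMeasurable
      (continuous_coe_char_ofAdd z).aestronglyMeasurable]
    congr 1
    · exact (hξ₁.integral_comp (continuous_coe_char_ofAdd y).aestronglyMeasurable).symm
    · exact (hξ₂.integral_comp (continuous_coe_char_ofAdd z).aestronglyMeasurable).symm
  have hmeas : Measurable fun x : X × X => ((u (Multiplicative.ofAdd x.1) : Circle) : ℂ) *
      ((v (Multiplicative.ofAdd x.2) : Circle) : ℂ) :=
    ((continuous_coe_char_ofAdd u).measurable.comp measurable_fst).mul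
      ((continuous_coe_char_ofAdd v).measurable.comp measurable_snd)
  have h := (hsymm.comp hmeas).integral_eq
  rw [hprod, hprod]
  refine Eq.trans (integral_congr_ae (ae_of_all _ fun ω => ?_)) (h.trans
    (integral_congr_ae (ae_of_all _ fun ω => ?_)))
  · change (((u (Multiplicative.ofAdd (ξ₁ ω)) * v (Multiplicative.ofAdd (ξ₁ ω)) : Circle) : ℂ)) *
      ((u (Multiplicative.ofAdd (ξ₂ ω)) * v (Multiplicative.ofAdd (α (ξ₂ ω))) : Circle) : ℂ) =
      ((u (Multiplicative.ofAdd (ξ₁ ω + ξ₂ ω)) : Circle) : ℂ) *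
      ((v (Multiplicative.ofAdd (ξ₁ ω + α (ξ₂ ω))) : Circle) : ℂ)
    simp only [ofAdd_add, map_mul, Circle.coe_mul]
    ring
  · change ((u (Multiplicative.ofAdd (ξ₁ ω + ξ₂ ω)) : Circle) : ℂ) *
      ((v (Multiplicative.ofAdd (-(ξ₁ ω + α (ξ₂ ω)))) : Circle) : ℂ) =
      (((u (Multiplicative.ofAdd (ξ₁ ω)) * (v (Multiplicative.ofAdd (ξ₁ ω)))⁻¹ : Circle) : ℂ)) *
      ((u (Multiplicative.ofAdd (ξ₂ ω)) * (v (Multiplicative.ofAdd (α (ξ₂ ω))))⁻¹ : Circle) : ℂ)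
    simp only [ofAdd_add, ofAdd_neg, map_mul, map_inv, Circle.coe_mul, mul_inv]
    ring

/-- On the finite cyclic subgroup generated by `y`, of odd order `n`, the adjoint of `α` is
multiplication by a unit of `ℤ / n`, so the functional equation on a finite ring applies. -/
theorem heyde_charFn {x₀ : X} (hx₀ : IsOddProcyclicGenerator x₀) (α : X ≃ₜ+ X)
    {μ₁ μ₂ : Measure X} [IsProbabilityMeasure μ₁] [IsProbabilityMeasure μ₂]
    (heq : ∀ u v : PontryaginDual (Multiplicative X),
      charFn μ₁ (u * v) * charFn μ₂ (u * charComp v (α : X →ₜ+ X)) =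
        charFn μ₁ (u / v) * charFn μ₂ (u / charComp v (α : X →ₜ+ X)))
    (hchar : ∀ y : PontryaginDual (Multiplicative X),
      ‖charFn μ₁ y‖ = 1 → ‖charFn μ₂ y‖ = 1 → y = 1)
    (y : PontryaginDual (Multiplicative X)) :
    charFn μ₁ y = charFn μ₂ y ∧ (y * charComp y (α : X →ₜ+ X) ≠ 1 → charFn μ₁ y = 0) := by
  obtain ⟨N, hN, hyN⟩ := hx₀.exists_odd_pow_eq_one y
  obtain ⟨n, hn⟩ : ∃ n, n = orderOf y := ⟨_, rfl⟩
  have hodd : Odd n := hN.of_dvd_nat (hn ▸ orderOf_dvd_of_pow_eq_one hyN)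
  have : NeZero n := ⟨hodd.pos.ne'⟩
  let ψ : ZMod n →+ Additive (PontryaginDual (Multiplicative X)) :=
    ZMod.lift n ⟨zmultiplesHom _ (Additive.ofMul y), by
      rw [zmultiplesHom_apply, natCast_zsmul, ← ofMul_pow, hn, pow_orderOf_eq_one, ofMul_one]⟩
  let c : ZMod n → PontryaginDual (Multiplicative X) := fun k => (ψ k).toMul
  have hcadd : ∀ k l, c (k + l) = c k * c l := fun k l => by simp [c]
  have hcsub : ∀ k l, c (k - l) = c k / c l := fun k l => by simp [c]
  have hcnat : ∀ m : ℕ, c (m : ZMod n) = y ^ m := by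
    intro m
    have h := ZMod.lift_coe n (f := ⟨zmultiplesHom _ (Additive.ofMul y), by
      rw [zmultiplesHom_apply, natCast_zsmul, ← ofMul_pow, hn, pow_orderOf_eq_one, ofMul_one]⟩) m
    rw [Int.cast_natCast] at h
    change (ψ m).toMul = _
    rw [h]
    simp
  have hsurj : ∀ k : ZMod n, ∃ m : ℕ, k = m := fun k => ⟨k.val, (ZMod.natCast_zmod_val k).symm⟩
  have hc0 : c 0 = 1 := by simp [c]
  have hc1 : c 1 = y := by simpa using hcnat 1
  have hcinj : ∀ k, c k = 1 → k = 0 := by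
    intro k hk
    obtain ⟨m, rfl⟩ := hsurj k
    rw [hcnat] at hk
    rw [ZMod.natCast_eq_zero_iff, hn]
    exact orderOf_dvd_of_pow_eq_one hk
  have hcmul : ∀ (m : ℕ) k, c (m * k) = c k ^ m := by
    intro m k
    obtain ⟨l, rfl⟩ := hsurj k
    rw [← Nat.cast_mul, hcnat, hcnat, ← pow_mul, mul_comm]
  obtain ⟨a, ha⟩ := hx₀.exists_charComp_eq_pow y (α : X →ₜ+ X)
  obtain ⟨b, hb⟩ := hx₀.exists_charComp_eq_pow y (α.symm : X →ₜ+ X)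
  have hcomp : ∀ k, charComp (c k) (α : X →ₜ+ X) = c (a * k) := by
    intro k
    obtain ⟨m, rfl⟩ := hsurj k
    rw [hcnat, charComp_pow, ha, hcmul, hcnat, ← pow_mul, ← pow_mul, mul_comm]
  have hunit : IsUnit (a : ZMod n) := by
    refine IsUnit.of_mul_eq_one (b : ZMod n) (sub_eq_zero.1 (hcinj _ ?_))
    have h : charComp (charComp y (α : X →ₜ+ X)) (α.symm : X →ₜ+ X) = y :=
      PontryaginDual.ext fun x =>
        congrArg (fun z => y (Multiplicative.ofAdd z)) (α.apply_symm_apply x.toAdd)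
    rw [ha, charComp_pow, hb] at h
    rw [hcsub, hcmul, hcnat, h, hc1, div_self']
  have htwo : IsUnit (2 : ZMod n) := by
    have := (ZMod.isUnit_iff_coprime 2 n).2 (Nat.coprime_two_left.2 hodd)
    exact_mod_cast this
  have hmul : ∀ (μ : Measure X) [IsProbabilityMeasure μ] (k l : ZMod n),
      ‖charFn μ (c l)‖ = 1 → ‖charFn μ (c (k * l))‖ = 1 := by
    intro μ _ k l h
    obtain ⟨m, rfl⟩ := hsurj k
    rw [hcmul]
    exact norm_charFn_pow_eq_one h m
  obtain ⟨h1, h2⟩ := heyde_ring htwo hunit (f := fun k => charFn μ₁ (c k))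
    (g := fun k => charFn μ₂ (c k)) (by simp only [hc0, charFn_one])
    (by simp only [hc0, charFn_one]) (fun _ => norm_charFn_le_one _ _)
    (fun _ => norm_charFn_le_one _ _) (hmul μ₁) (hmul μ₂)
    (fun w h1 h2 => hcinj _ (hchar _ h1 h2)) (fun u v => by
      simp only [hcadd, hcsub, ← hcomp]
      exact heq _ _)
  have h1' := congrFun h1 1
  have h2' := h2 1
  simp only [hc1] at h1' h2'
  refine ⟨h1', fun hy => h2' fun h => hy ?_⟩
  rw [mul_one] at h
  rw [ha, ← hcnat a, ← hc0, ← h, hcadd, hc1]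

end Heyde

/-! ### Heyde's characterization on products of cyclic and p-adic groups -/

theorem corollary2p6
    {S : Set ℕ} (hprime : ∀ p ∈ S, Nat.Prime p) (htwo : 2 ∉ S)
    {F : S → Type*} [∀ p, AddCommGroup (F p)] [∀ p, TopologicalSpace (F p)]
    (hF : ∀ p : S, IsCyclicOrPadic (p : ℕ) (F p))
    {X : Type*} [AddCommGroup X] [TopologicalSpace X] [IsTopologicalAddGroup X]
    [CompactSpace X] [TotallyDisconnectedSpace X] [MeasurableSpace X] [BorelSpace X]
    (e : X ≃ₜ+ (∀ p : S, F p))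
    (α : X ≃ₜ+ X)
    {Ω : Type*} [MeasurableSpace Ω] (P : Measure Ω) [IsProbabilityMeasure P]
    (ξ₁ ξ₂ : Ω → X) (μ₁ μ₂ : Measure X)
    (hξ₁ : HasLaw ξ₁ μ₁ P) (hξ₂ : HasLaw ξ₂ μ₂ P) (hindep : IndepFun ξ₁ ξ₂ P)
    (hsymm : CondSymmetric (fun ω => ξ₁ ω + α (ξ₂ ω)) (fun ω => ξ₁ ω + ξ₂ ω) P)
    (hchar : {y : PontryaginDual (Multiplicative X) |
      ‖charFn μ₁ y‖ = 1 ∧ ‖charFn μ₂ y‖ = 1} = {1}) :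
    (idSub α).range = ⊤ ∧
    ∃ μ : Measure X, μ₁ = μ ∧ μ₂ = μ ∧
      IsLeast {H : AddSubgroup X | IsClosed (H : Set X) ∧ μ.support ⊆ (H : Set X)} ⊤ ∧
      IsFactor (haarDistribution (idAdd α).range) μ := by
  have hsc : SecondCountableTopology X := by
    have : ∀ p : S, SecondCountableTopology (F p) :=
      fun p => (hF p).secondCountableTopology (hprime p p.2)
    exact e.toHomeomorph.secondCountableTopology
  have : IsProbabilityMeasure μ₁ := hξ₁.isProbabilityMeasure_iff.1 inferInstance
  have : IsProbabilityMeasure μ₂ := hξ₂.isProbabilityMeasure_iff.1 inferInstance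
  obtain ⟨x₀, hx₀⟩ := exists_isOddProcyclicGenerator hprime htwo hF e
  have hchar' : ∀ y : PontryaginDual (Multiplicative X),
      ‖charFn μ₁ y‖ = 1 → ‖charFn μ₂ y‖ = 1 → y = 1 := fun y h1 h2 => hchar.le ⟨h1, h2⟩
  have heq := CondSymmetric.charFn_mul_charFn (α := (α : X →ₜ+ X)) hξ₁ hξ₂ hindep hsymm
  have hkey := heyde_charFn hx₀ α heq hchar'
  have hμ : μ₂ = μ₁ := ext_of_charFn fun y => (hkey y).1.symm
  refine ⟨?_, μ₁, rfl, hμ, isLeast_top_of_charFn_eq_one fun y hy => ?_,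
    isFactor_haarDistribution _ ?_⟩
  · -- A character trivial on `(I - α)(X)` is fixed by the adjoint of `α`; the functional equation
    -- with `u = v = y` then gives `|μ̂₁(2y)| = |μ̂₂(2y)| = 1`.
    have hcont : Continuous (idSub α) := by
      change Continuous fun x => x - α x
      exact continuous_id.sub α.continuous_toFun
    have hclosed : IsClosed ((idSub α).range : Set X) := by
      rw [AddMonoidHom.coe_range]
      exact (isCompact_range hcont).isClosed
    refine top_unique fun x _ => by_contra fun hx => ?_
    obtain ⟨y, hy, hyx⟩ := exists_char_eq_one_of_isClosed hclosed hx
    refine hyx ?_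
    have hfix : charComp y (α : X →ₜ+ X) = y := by
      refine PontryaginDual.ext fun z => ?_
      have h := hy (z.toAdd - α z.toAdd) ⟨z.toAdd, rfl⟩
      rw [ofAdd_sub, map_div, div_eq_one] at h
      exact h.symm
    have h := heq y y
    rw [hfix, div_self', charFn_one, charFn_one, one_mul] at h
    have hn : ‖charFn μ₁ (y * y)‖ * ‖charFn μ₂ (y * y)‖ = 1 := by
      rw [← norm_mul, h, norm_one]
    have h1 := norm_charFn_le_one μ₁ (y * y)
    have h2 := norm_charFn_le_one μ₂ (y * y)
    have h3 := norm_nonneg (charFn μ₁ (y * y))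
    have h4 := norm_nonneg (charFn μ₂ (y * y))
    have hyy : y ^ 2 = 1 := by
      rw [pow_two]
      exact hchar' _ (by nlinarith) (by nlinarith)
    obtain ⟨N, ⟨k, rfl⟩, hyN⟩ := hx₀.exists_odd_pow_eq_one y
    rw [pow_succ, pow_mul, hyy, one_pow, one_mul] at hyN
    rw [hyN, PontryaginDual.one_apply]
  · have h1 : ‖charFn μ₁ y‖ = 1 := by rw [hy, norm_one]
    exact hchar' y h1 (by rw [hμ, h1])
  · rintro y _ ⟨x, rfl⟩ hyx
    refine (hkey y).2 fun h => hyx ?_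
    have h' := DFunLike.congr_fun h (Multiplicative.ofAdd x)
    change y (Multiplicative.ofAdd (x + α x)) = 1
    rw [ofAdd_add, map_mul]
    exact h'
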